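/- For real $x$ or complex $z$ put $J_0(z)=\sum_{k\ge 0}\frac{(-1)^k (z/2)^{2k}}{(k!)^2}$, $I_0(x)=\sum_{k\ge 0}\frac{(x/2)^{2k}}{(k!)^2}$, and for $t>0$ put $K_0(t)=\int_0^\infty e^{-t\cosh u}\,du$ (the Bessel and modified Bessel functions of order $0$). Let $\operatorname{ber}$ and $\operatorname{bei}$ be the Kelvin functions, $\operatorname{ber}(x)+i\operatorname{bei}(x)=J_0\!\left(x e^{3\pi i/4}\right)$ for $x\in\mathbb{R}$, with both functions real-valued. Then for all real $a$ and $y$ the following four integrals converge absolutely and $$\frac{\pi}{2}(1+y^2)^{-1/2}J_0\!\left(\frac{a^2}{4}\right)\cosh\!\left(\frac{a^2y}{4}\right)=\int_0^\infty K_0(t)\,\operatorname{ber}\!\left(a\sqrt{(1+y^2)t}\right)\cos(yt)\,dt,$$ $$\frac{\pi}{2}(1+y^2)^{-1/2}J_0\!\left(\frac{a^2}{4}\right)\sinh\!\left(\frac{a^2y}{4}\right)=\int_0^\infty K_0(t)\,\operatorname{bei}\!\left(a\sqrt{(1+y^2)t}\right)\sin(yt)\,dt,$$ $$(1+y^2)^{-1/2}I_0\!\left(\frac{a^2y}{4}\right)\cos\!\left(\frac{a^2}{4}\right)=\int_0^\infty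 e^{-t}\,\operatorname{ber}\!\left(a\sqrt{(1+y^2)t}\right)J_0(yt)\,dt,$$ $$(1+y^2)^{-1/2}I_0\!\left(\frac{a^2y}{4}\right)\sin\!\left(\frac{a^2}{4}\right)=\int_0^\infty e^{-t}\,\operatorname{bei}\!\left(a\sqrt{(1+y^2)t}\right)J_0(yt)\,dt.$$ -/

import Mathlib

open Real Set MeasureTheory
open scoped Nat

noncomputable section

/-- The Bessel function of the first kind of order zero, over `ℝ` or `ℂ`,
`J₀(z) = ∑ₖ (-1)ᵏ (z/2)²ᵏ / (k!)²`. -/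
def besselJ0 {𝕜 : Type*} [RCLike 𝕜] (z : 𝕜) : 𝕜 :=
  ∑' k : ℕ, (-1) ^ k * (z / 2) ^ (2 * k) / ((k ! : ℕ) : 𝕜) ^ 2

/-- The modified Bessel function of the first kind of order zero,
`I₀(x) = ∑ₖ (x/2)²ᵏ / (k!)²`. -/
def besselI0 (x : ℝ) : ℝ :=
  ∑' k : ℕ, (x / 2) ^ (2 * k) / ((k ! : ℕ) : ℝ) ^ 2

/-- The modified Bessel function of the second kind (Macdonald function) of order zero at `t > 0`,
`K₀(t) = ∫₀^∞ exp(-t cosh u) du`. Only the values at `t > 0` are meaningful. -/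
def besselK0 (t : ℝ) : ℝ :=
  ∫ u in Ioi (0 : ℝ), Real.exp (-t * Real.cosh u)

/-- The Kelvin function `ber x = Re J₀(x e^{3πi/4})`. -/
def kelvinBer (x : ℝ) : ℝ :=
  (besselJ0 ((x : ℂ) * Complex.exp (3 * (π : ℂ) * Complex.I / 4))).re

/-- The Kelvin function `bei x = Im J₀(x e^{3πi/4})`. -/
def kelvinBei (x : ℝ) : ℝ :=
  (besselJ0 ((x : ℂ) * Complex.exp (3 * (π : ℂ) * Complex.I / 4))).im

end

open Real Set MeasureTheory
open scoped Nat

/-! Write E(z) = ∑ zᵏ/(k!)² (`besselSeries`) and c = a²/4. Since (e^{3πi/4})² = -i, ber + i bei at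
a√((1+y²)t) is E(ic(1+y²)t). This series is integrated termwise against h(t) = e^{-t}J₀(yt) or h(t)
= K₀(t)e^{iyt}. The absolute moments of h are O(k!), so the sum is dominated by an exponential
series (`integrable_and_hasSum_besselSeries_mul`).

The moments are derivatives of known transforms, ∫ e^{-lt}J₀(yt) dt = (l²+y²)^{-1/2} at l = 1 and ∫
K₀(t)cos(yt) dt = (π/2)(y²+1)^{-1/2}. So both cases rest on the derivatives of (x²+m²)^{-1/2}: up to
sign the k-th is (k!)² S_k(x)/(x²+m²)^{k+1/2}, where ∑ rᵏS_k(x) = e^{rx}E(-r²m²/4)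
(`hasDerivAt_invSqrtDeriv`, `hasSum_pow_mul_legendreCoeff`). The (k!)² cancels the denominator of E,
and the factor (1+y²)ᵏ cancels the power of x²+m², leaving exactly this generating function.

For J₀ one has r = ic, x = 1, m = y, giving e^{ic}I₀(cy); its real and imaginary parts are the last
two identities. For K₀ one has r = -c, x = y, m = 1, giving e^{-cy}J₀(c) for the real part only; the
parts even and odd in y are the first two identities. -/

/-! ### Legendre-type polynomials and the derivatives of (x²+m²)^{-1/2}. -/

/-- The coefficients of the even exponential-type series `∑ⱼ wʲ r²ʲ / (j!)²` in `r`. -/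
noncomputable def evenBesselCoeff (w : ℝ) (k : ℕ) : ℝ :=
  if Even k then w ^ (k / 2) / ((k / 2)! : ℝ) ^ 2 else 0

/-- The coefficients in `r` of `e^{rx} ∑ⱼ wʲ r²ʲ / (j!)²`. Up to scaling these are the Legendre
polynomials divided by factorials. -/
noncomputable def legendreCoeff (w : ℝ) (k : ℕ) (x : ℝ) : ℝ :=
  ∑ p ∈ Finset.HasAntidiagonal.antidiagonal k, x ^ p.1 / (p.1 ! : ℝ) * evenBesselCoeff w p.2

/-- The derivative of `legendreCoeff`. -/
noncomputable def legendreCoeffDeriv (w : ℝ) : ℕ → ℝ → ℝ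
  | 0, _ => 0
  | k + 1, x => legendreCoeff w k x

/-- This is the case x = 0 of the three-term recurrence. -/
lemma evenBesselCoeff_recurrence (w : ℝ) (k : ℕ) :
    ((k : ℝ) + 2) ^ 2 * evenBesselCoeff w (k + 2) = 4 * w * evenBesselCoeff w k := by
  rcases Nat.even_or_odd' k with ⟨m, rfl | rfl⟩
  · have h1 : Even (2 * m + 2) := ⟨m + 1, by ring⟩
    have h2 : (2 * m + 2) / 2 = m + 1 := by omega
    simp only [evenBesselCoeff, h1, h2, even_two_mul, if_true, Nat.factorial_succ,
      Nat.mul_div_cancel_left m two_pos]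
    have : ((m)! : ℝ) ≠ 0 := by positivity
    push_cast
    field_simp
    ring
  · have h1 : ¬ Even (2 * m + 1 + 2) := by
      rw [Nat.not_even_iff_odd]; exact ⟨m + 1, by ring⟩
    have h2 : ¬ Even (2 * m + 1) := by
      rw [Nat.not_even_iff_odd]; exact ⟨m, by ring⟩
    simp [evenBesselCoeff, h1, h2]

lemma legendreCoeff_zero (w x : ℝ) : legendreCoeff w 0 x = 1 := by
  simp [legendreCoeff, evenBesselCoeff]

lemma legendreCoeff_one (w x : ℝ) : legendreCoeff w 1 x = x := by
  simp [legendreCoeff, evenBesselCoeff, Finset.Nat.antidiagonal_succ]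

lemma legendreCoeff_at_zero (w : ℝ) (k : ℕ) : legendreCoeff w k 0 = evenBesselCoeff w k := by
  rw [legendreCoeff, Finset.sum_eq_single (0, k)]
  · simp
  · rintro ⟨i, j⟩ hp hne
    have hi : i ≠ 0 := by
      rintro rfl
      simp at hp
      simp [hp] at hne
    simp [hi]
  · simp

/-- Appell property: differentiating e^{rx} multiplies the generating function by r, which shifts
the index. -/
lemma hasDerivAt_legendreCoeff (w : ℝ) (k : ℕ) (x : ℝ) :
    HasDerivAt (legendreCoeff w k) (legendreCoeffDeriv w k x) x := by
  cases k with
  | zero =>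
    have : legendreCoeff w 0 = fun _ => 1 := funext (legendreCoeff_zero w)
    rw [this]
    exact hasDerivAt_const _ _
  | succ k =>
    have : legendreCoeff w (k + 1) = fun x => evenBesselCoeff w (k + 1) +
        ∑ p ∈ Finset.HasAntidiagonal.antidiagonal k,
          x ^ (p.1 + 1) / ((p.1 + 1)! : ℝ) * evenBesselCoeff w p.2 := by
      funext x
      simp [legendreCoeff, Finset.Nat.antidiagonal_succ]
    rw [this]
    refine HasDerivAt.const_add _ (HasDerivAt.fun_sum fun p _ => ?_)
    refine HasDerivAt.mul_const ?_ _
    have h := (hasDerivAt_pow (p.1 + 1) x).div_const ((p.1 + 1)! : ℝ)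
    convert h using 1
    have : ((p.1)! : ℝ) ≠ 0 := by positivity
    simp only [Nat.factorial_succ, Nat.add_sub_cancel]
    push_cast
    field_simp

/-- The three-term recurrence for Legendre polynomials, in the form of a derivative rule. -/
lemma legendreCoeff_recurrence (w : ℝ) (k : ℕ) (x : ℝ) :
    ((k : ℝ) + 1) ^ 2 * legendreCoeff w (k + 1) x =
      (2 * k + 1) * x * legendreCoeff w k x - (x ^ 2 - 4 * w) * legendreCoeffDeriv w k x := by
  induction k generalizing x with
  | zero => simp [legendreCoeff_zero, legendreCoeff_one, legendreCoeffDeriv]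
  | succ k ih =>
    -- `D` is the defect of the recurrence. By the Appell property its derivative is the defect one
    -- index lower, which vanishes by induction, so `D` equals its value at 0.
    set D : ℝ → ℝ := fun x => ((k + 1 : ℕ) + 1 : ℝ) ^ 2 * legendreCoeff w (k + 2) x -
      ((2 * (k + 1 : ℕ) + 1) * x * legendreCoeff w (k + 1) x -
        (x ^ 2 - 4 * w) * legendreCoeff w k x) with hD
    have hderiv : ∀ x, HasDerivAt D 0 x := by
      intro x
      have h2 := (hasDerivAt_legendreCoeff w (k + 2) x).const_mul (((k + 1 : ℕ) + 1 : ℝ) ^ 2)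
      have h1 := (((hasDerivAt_id x).const_mul (2 * ((k + 1 : ℕ) : ℝ) + 1)).mul
        (hasDerivAt_legendreCoeff w (k + 1) x))
      have h0 := (((hasDerivAt_pow 2 x).sub_const (4 * w)).mul
        (hasDerivAt_legendreCoeff w k x))
      have h := h2.sub (h1.sub h0)
      refine h.congr_deriv ?_
      have := ih x
      simp only [legendreCoeffDeriv, id] at this ⊢
      push_cast
      linear_combination this
    have hconst : D x = D 0 :=
      is_const_of_deriv_eq_zero (fun x => (hderiv x).differentiableAt)
        (fun x => (hderiv x).deriv) x 0
    have h0 : D 0 = 0 := by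
      have := evenBesselCoeff_recurrence w k
      simp only [hD, legendreCoeff_at_zero]
      push_cast
      linear_combination this
    rw [h0] at hconst
    simp only [hD] at hconst
    simp only [legendreCoeffDeriv]
    linarith

/-- The `k`-th derivative of `x ↦ (x² + m²)^{-1/2}`. -/
noncomputable def invSqrtDeriv (m : ℝ) (k : ℕ) (x : ℝ) : ℝ :=
  (-1) ^ k * (k ! : ℝ) ^ 2 * legendreCoeff (-(m ^ 2 / 4)) k x /
    ((x ^ 2 + m ^ 2) ^ k * √(x ^ 2 + m ^ 2))

/-- With w = -m²/4 one has x² - 4w = x² + m², and the numerator produced by the quotient rule is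
minus the right side of the three-term recurrence. -/
lemma hasDerivAt_invSqrtDeriv (m : ℝ) (k : ℕ) {x : ℝ} (hx : 0 < x ^ 2 + m ^ 2) :
    HasDerivAt (invSqrtDeriv m k) (invSqrtDeriv m (k + 1) x) x := by
  have hP : HasDerivAt (fun x : ℝ => x ^ 2 + m ^ 2) (2 * x) x := by
    simpa using (hasDerivAt_pow 2 x).add_const (m ^ 2)
  have hs := hP.sqrt hx.ne'
  have hk := hP.fun_pow k
  have hS := (hasDerivAt_legendreCoeff (-(m ^ 2 / 4)) k x).const_mul ((-1) ^ k * (k ! : ℝ) ^ 2)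
  have hpos : 0 < √(x ^ 2 + m ^ 2) := Real.sqrt_pos.2 hx
  have hsq : √(x ^ 2 + m ^ 2) ^ 2 = x ^ 2 + m ^ 2 := Real.sq_sqrt hx.le
  have h := hS.div (hk.mul hs) (mul_pos (pow_pos hx k) hpos).ne'
  refine h.congr_deriv ?_
  have hrec := legendreCoeff_recurrence (-(m ^ 2 / 4)) k x
  simp only [invSqrtDeriv, Nat.factorial_succ]
  simp only [Pi.mul_apply]
  push_cast
  set s := √(x ^ 2 + m ^ 2)
  clear_value s
  set S := legendreCoeff (-(m ^ 2 / 4)) k x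
  set T := legendreCoeffDeriv (-(m ^ 2 / 4)) k x
  have hrec' : ((k : ℝ) + 1) ^ 2 * legendreCoeff (-(m ^ 2 / 4)) (k + 1) x =
      (2 * k + 1) * x * S - s ^ 2 * T := by
    rw [hrec, hsq]; ring
  have e1 : (-1 : ℝ) ^ (k + 1) * (((k : ℝ) + 1) * (k ! : ℝ)) ^ 2 *
      legendreCoeff (-(m ^ 2 / 4)) (k + 1) x =
      (-1) ^ (k + 1) * (k ! : ℝ) ^ 2 * ((2 * k + 1) * x * S - s ^ 2 * T) := by
    rw [← hrec']; ring
  rw [e1]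
  rw [div_eq_div_iff (by positivity) (by positivity)]
  rw [← hsq]
  -- The derivative of (x²+m²)ᵏ carries the truncated exponent `k - 1`.
  rcases k with _ | k
  · field_simp
    simp
    ring
  · simp only [Nat.add_sub_cancel]
    push_cast
    field_simp
    ring

/-- A tower of derivatives over an open set starting at `C (x² + m²)^{-1/2}`. -/
lemma eq_invSqrtDeriv_of_hasDerivAt {U : Set ℝ} (hU : IsOpen U) {m C : ℝ}
    (hpos : ∀ x ∈ U, 0 < x ^ 2 + m ^ 2) {g : ℕ → ℝ → ℝ}
    (hg : ∀ k, ∀ x ∈ U, HasDerivAt (g k) (g (k + 1) x) x)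
    (h0 : ∀ x ∈ U, g 0 x = C / √(x ^ 2 + m ^ 2)) (k : ℕ) :
    ∀ x ∈ U, g k x = C * invSqrtDeriv m k x := by
  induction k with
  | zero =>
    intro x hx
    rw [h0 x hx]
    simp [invSqrtDeriv, legendreCoeff_zero, div_eq_mul_inv]
  | succ k ih =>
    intro x hx
    have h1 := (hasDerivAt_invSqrtDeriv m k (hpos x hx)).const_mul C
    have h2 := h1.congr_of_eventuallyEq (f₁ := g k)
      (Filter.eventually_of_mem (hU.mem_nhds hx) ih)
    exact (hg k x hx).unique h2

/-! ### The generating function. -/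

lemma summable_norm_pow_div_factorial_sq (z : ℂ) :
    Summable fun k : ℕ => ‖z ^ k / (k ! : ℂ) ^ 2‖ := by
  refine Summable.of_nonneg_of_le (fun _ => norm_nonneg _) (fun k => ?_)
    (Real.summable_pow_div_factorial ‖z‖)
  rw [norm_div, norm_pow, norm_pow, Complex.norm_natCast]
  have h : (1 : ℝ) ≤ k ! := by exact_mod_cast Nat.one_le_iff_ne_zero.2 (Nat.factorial_ne_zero k)
  gcongr
  nlinarith

/-- The generating function of `legendreCoeff`. -/
lemma hasSum_pow_mul_legendreCoeff (w x : ℝ) (r : ℂ) :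
    HasSum (fun k : ℕ => r ^ k * (legendreCoeff w k x : ℂ))
      (Complex.exp (r * x) * ∑' k : ℕ, (r ^ 2 * w) ^ k / (k ! : ℂ) ^ 2) := by
  have hf : Summable fun k : ℕ => ‖(r * x) ^ k / (k ! : ℂ)‖ :=
    NormedSpace.norm_expSeries_div_summable (𝔸 := ℂ) (r * x)
  have hinj : Function.Injective fun k : ℕ => 2 * k := fun a b h => by simpa using h
  set v : ℕ → ℂ := fun k => r ^ k * (evenBesselCoeff w k : ℂ) with hv
  have hv2 : ∀ k, v (2 * k) = (r ^ 2 * w) ^ k / (k ! : ℂ) ^ 2 := by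
    intro k
    simp [hv, evenBesselCoeff]
    ring
  have hv0 : ∀ k ∉ Set.range (fun k : ℕ => 2 * k), v k = 0 := by
    intro k hk
    have : ¬ Even k := by
      rintro ⟨m, rfl⟩
      exact hk ⟨m, by simp; ring⟩
    simp [hv, evenBesselCoeff, this]
  have hg : Summable fun k => ‖v k‖ := by
    rw [← hinj.summable_iff (fun k hk => by rw [hv0 k hk, norm_zero])]
    simpa only [Function.comp_def, hv2] using summable_norm_pow_div_factorial_sq (r ^ 2 * w)
  have hgt : ∑' k, v k = ∑' k : ℕ, (r ^ 2 * w) ^ k / (k ! : ℂ) ^ 2 := by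
    rw [← hinj.tsum_eq (fun k hk => by_contra fun h => hk (hv0 k h))]
    simp only [hv2]
  have hexp : Complex.exp (r * x) = ∑' k : ℕ, (r * x) ^ k / (k ! : ℂ) := by
    rw [Complex.exp_eq_exp_ℂ, NormedSpace.exp_eq_tsum_div]
  rw [hexp, ← hgt, tsum_mul_tsum_eq_tsum_sum_antidiagonal_of_summable_norm hf hg]
  have hs := (summable_norm_sum_mul_antidiagonal_of_summable_norm hf hg).of_norm.hasSum
  have hterm : ∀ k, r ^ k * (legendreCoeff w k x : ℂ) =
      ∑ p ∈ Finset.HasAntidiagonal.antidiagonal k, (r * x) ^ p.1 / (p.1 ! : ℂ) * v p.2 := by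
    intro k
    simp only [legendreCoeff]
    push_cast
    rw [Finset.mul_sum]
    refine Finset.sum_congr rfl fun p hp => ?_
    rw [← Finset.HasAntidiagonal.mem_antidiagonal.1 hp, hv]
    simp only [pow_add, mul_pow]
    ring
  simp only [hterm]
  exact hs

/-! ### J₀, I₀, ber and bei in terms of one entire series. -/

/-- The entire function `∑ₖ zᵏ / (k!)²`. -/
noncomputable def besselSeries (z : ℂ) : ℂ := ∑' k : ℕ, z ^ k / (k ! : ℂ) ^ 2

lemma hasSum_besselSeries (z : ℂ) : HasSum (fun k : ℕ => z ^ k / (k ! : ℂ) ^ 2) (besselSeries z) :=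
  (summable_norm_pow_div_factorial_sq z).of_norm.hasSum

lemma besselJ0_eq_besselSeries (z : ℂ) : besselJ0 z = besselSeries (-(z ^ 2 / 4)) := by
  unfold besselJ0 besselSeries
  refine tsum_congr fun k => ?_
  congr 1
  rw [pow_mul, ← mul_pow]
  congr 1
  ring

lemma ofReal_besselJ0 (x : ℝ) : ((besselJ0 x : ℝ) : ℂ) = besselSeries (-((x : ℂ) ^ 2 / 4)) := by
  rw [← besselJ0_eq_besselSeries]
  unfold besselJ0
  push_cast
  rfl

lemma ofReal_besselI0 (x : ℝ) : (besselI0 x : ℂ) = besselSeries ((x : ℂ) ^ 2 / 4) := by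
  unfold besselI0 besselSeries
  push_cast
  refine tsum_congr fun k => ?_
  congr 1
  rw [pow_mul]
  congr 1
  ring

lemma besselJ0_kelvin (x : ℝ) :
    besselJ0 ((x : ℂ) * Complex.exp (3 * (π : ℂ) * Complex.I / 4)) =
      besselSeries (Complex.I * ((x ^ 2 / 4 : ℝ) : ℂ)) := by
  rw [besselJ0_eq_besselSeries]
  congr 1
  rw [mul_pow, ← Complex.exp_nat_mul]
  have : ((2 : ℕ) : ℂ) * (3 * (π : ℂ) * Complex.I / 4) = π * Complex.I + π / 2 * Complex.I := by
    push_cast; ring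
  rw [this, Complex.exp_add, Complex.exp_pi_mul_I, Complex.exp_pi_div_two_mul_I]
  push_cast
  ring

lemma kelvin_argument (a y : ℝ) {t : ℝ} (ht : 0 ≤ t) :
    (a * √((1 + y ^ 2) * t)) ^ 2 / 4 = a ^ 2 / 4 * (1 + y ^ 2) * t := by
  rw [mul_pow, Real.sq_sqrt (by positivity)]
  ring

lemma kelvinBer_eq (a y : ℝ) {t : ℝ} (ht : 0 ≤ t) :
    kelvinBer (a * √((1 + y ^ 2) * t)) =
      (besselSeries (Complex.I * ((a ^ 2 / 4 * (1 + y ^ 2) : ℝ) : ℂ) * t)).re := by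
  rw [kelvinBer, besselJ0_kelvin, kelvin_argument a y ht]
  push_cast
  ring_nf

lemma kelvinBei_eq (a y : ℝ) {t : ℝ} (ht : 0 ≤ t) :
    kelvinBei (a * √((1 + y ^ 2) * t)) =
      (besselSeries (Complex.I * ((a ^ 2 / 4 * (1 + y ^ 2) : ℝ) : ℂ) * t)).im := by
  rw [kelvinBei, besselJ0_kelvin, kelvin_argument a y ht]
  push_cast
  ring_nf

/-! ### Bessel's integral, continuity and boundedness of J₀. -/

/-- Puts the Wallis product for ∫ sin²ⁿ in a form where (2n)! cancels against the cosine series. -/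
lemma prod_range_odd_div_even (n : ℕ) :
    ∏ i ∈ Finset.range n, ((2 * i + 1 : ℝ) / (2 * i + 2)) =
      ((2 * n)! : ℝ) / (4 ^ n * (n ! : ℝ) ^ 2) := by
  induction n with
  | zero => simp
  | succ n ih =>
    rw [Finset.prod_range_succ, ih, show 2 * (n + 1) = 2 * n + 1 + 1 by ring]
    simp only [Nat.factorial_succ]
    have : ((n)! : ℝ) ≠ 0 := by positivity
    push_cast
    field_simp
    ring

/-- Bessel's integral for `J₀`. -/
lemma besselJ0_eq_integral (x : ℝ) :
    besselJ0 x = 1 / π * ∫ θ in (0 : ℝ)..π, Real.cos (x * Real.sin θ) := by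
  have h : HasSum (fun n : ℕ => ∫ θ in (0 : ℝ)..π,
        (-1) ^ n * (x * Real.sin θ) ^ (2 * n) / ((2 * n)! : ℝ))
      (∫ θ in (0 : ℝ)..π, Real.cos (x * Real.sin θ)) := by
    refine intervalIntegral.hasSum_integral_of_dominated_convergence
      (fun n _ => |x| ^ (2 * n) / ((2 * n)! : ℝ)) (fun n => ?_) (fun n => ?_) ?_ ?_ ?_
    · exact Continuous.aestronglyMeasurable (by fun_prop)
    · refine Filter.Eventually.of_forall fun θ _ => ?_
      rw [norm_div, norm_mul, norm_pow, norm_neg, norm_one, one_pow, one_mul, norm_pow, norm_mul,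
        Real.norm_eq_abs, Real.norm_eq_abs, Real.norm_natCast]
      have := Real.abs_sin_le_one θ
      gcongr
      exact mul_le_of_le_one_right (abs_nonneg x) this
    · refine Filter.Eventually.of_forall fun θ _ => ?_
      exact (Real.summable_pow_div_factorial |x|).comp_injective
        (i := fun n : ℕ => 2 * n) (fun a b h => by simpa using h)
    · exact intervalIntegrable_const
    · exact Filter.Eventually.of_forall fun θ _ => Real.hasSum_cos _
  rw [← h.tsum_eq, besselJ0, ← tsum_mul_left]
  refine tsum_congr fun n => ?_
  have : ∀ θ : ℝ, (-1) ^ n * (x * Real.sin θ) ^ (2 * n) / ((2 * n)! : ℝ) =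
      (-1) ^ n * x ^ (2 * n) / ((2 * n)! : ℝ) * Real.sin θ ^ (2 * n) := by
    intro θ
    rw [mul_pow]; ring
  simp only [this]
  rw [intervalIntegral.integral_const_mul, integral_sin_pow_even, prod_range_odd_div_even]
  have h1 : ((n)! : ℝ) ≠ 0 := by positivity
  have h2 : ((2 * n)! : ℝ) ≠ 0 := by positivity
  have h4 : (4 : ℝ) ^ n = 2 ^ (2 * n) := by rw [pow_mul]; norm_num
  rw [h4, div_pow]
  field_simp

lemma continuous_besselJ0 : Continuous (besselJ0 : ℝ → ℝ) := by
  have : (besselJ0 : ℝ → ℝ) = fun x => 1 / π * ∫ θ in (0 : ℝ)..π, Real.cos (x * Real.sin θ) :=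
    funext besselJ0_eq_integral
  rw [this]
  refine continuous_const.mul ?_
  refine intervalIntegral.continuous_parametric_intervalIntegral_of_continuous' ?_ 0 π
  simp only [Function.uncurry_def]
  fun_prop

lemma abs_besselJ0_le_one (x : ℝ) : |besselJ0 x| ≤ 1 := by
  rw [besselJ0_eq_integral, abs_mul, abs_of_pos (by positivity : 0 < 1 / π)]
  have h := intervalIntegral.norm_integral_le_of_norm_le_const
    (a := 0) (b := π) (f := fun θ => Real.cos (x * Real.sin θ)) (C := 1)
    (fun θ _ => Real.abs_cos_le_one _)
  rw [sub_zero, abs_of_pos Real.pi_pos, one_mul, Real.norm_eq_abs] at h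
  rw [one_div, inv_mul_le_iff₀ Real.pi_pos, mul_one]
  exact h

/-! ### Termwise integration. -/

/-- Termwise integration of a power series against a function with controlled moments. -/
lemma integrable_and_hasSum_besselSeries_mul {h : ℝ → ℂ} {C : ℝ}
    (hint : ∀ k : ℕ, IntegrableOn (fun t : ℝ => (t : ℂ) ^ k * h t) (Ioi 0))
    (hC : ∀ k : ℕ, ∫ t in Ioi (0 : ℝ), ‖(t : ℂ) ^ k * h t‖ ≤ C * (k ! : ℝ)) (z : ℂ) :
    IntegrableOn (fun t : ℝ => besselSeries (z * t) * h t) (Ioi 0) ∧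
    HasSum (fun k : ℕ => z ^ k / (k ! : ℂ) ^ 2 * ∫ t in Ioi (0 : ℝ), (t : ℂ) ^ k * h t)
      (∫ t in Ioi (0 : ℝ), besselSeries (z * t) * h t) := by
  set F : ℕ → ℝ → ℂ := fun k t => z ^ k / (k ! : ℂ) ^ 2 * ((t : ℂ) ^ k * h t) with hF
  have hFsum : ∀ t, HasSum (fun k => F k t) (besselSeries (z * t) * h t) := by
    intro t
    have hterm : ∀ k, F k t = (z * t) ^ k / (k ! : ℂ) ^ 2 * h t := fun k => by
      simp only [hF, mul_pow]
      ring
    simp only [hterm]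
    exact (hasSum_besselSeries (z * t)).mul_right (h t)
  have hFint : ∀ k, Integrable (F k) (volume.restrict (Ioi 0)) := fun k => (hint k).const_mul _
  -- A moment of size k! against (k!)² leaves a term of the exponential series.
  have hnorm : ∀ k, ∫ t in Ioi (0 : ℝ), ‖F k t‖ ≤ C * (‖z‖ ^ k / (k ! : ℝ)) := by
    intro k
    have h1 : ∀ t, ‖F k t‖ = ‖z‖ ^ k / (k ! : ℝ) ^ 2 * ‖(t : ℂ) ^ k * h t‖ := by
      intro t
      simp [hF]
    simp only [h1]
    rw [integral_const_mul]
    have hk : (0 : ℝ) < k ! := by positivity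
    calc _ ≤ ‖z‖ ^ k / (k ! : ℝ) ^ 2 * (C * (k ! : ℝ)) :=
          mul_le_mul_of_nonneg_left (hC k) (by positivity)
      _ = _ := by field_simp
  have hsummable : Summable fun k => ∫ t in Ioi (0 : ℝ), ‖F k t‖ :=
    Summable.of_nonneg_of_le (fun k => integral_nonneg fun t => norm_nonneg _) hnorm
      ((Real.summable_pow_div_factorial ‖z‖).mul_left C)
  have htsum : (fun t : ℝ => besselSeries (z * t) * h t) = fun t => ∑' k, F k t :=
    funext fun t => (hFsum t).tsum_eq.symm
  constructor
  · refine ⟨?_, ?_⟩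
    · refine aestronglyMeasurable_of_tendsto_ae Filter.atTop
        (f := fun (n : ℕ) (t : ℝ) => ∑ k ∈ Finset.range n, F k t) (fun n => ?_) ?_
      · exact (integrable_finsetSum _ fun k _ => hFint k).aestronglyMeasurable
      · exact Filter.Eventually.of_forall fun t => (hFsum t).tendsto_sum_nat
    · rw [hasFiniteIntegral_iff_enorm]
      calc ∫⁻ t in Ioi (0 : ℝ), ‖besselSeries (z * t) * h t‖ₑ
          ≤ ∫⁻ t in Ioi (0 : ℝ), ∑' k, ‖F k t‖ₑ := by
            refine lintegral_mono fun t => ?_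
            rw [← (hFsum t).tsum_eq]
            exact enorm_tsum_le_tsum_enorm
        _ = ∑' k, ∫⁻ t in Ioi (0 : ℝ), ‖F k t‖ₑ :=
            lintegral_tsum fun k => (hFint k).aestronglyMeasurable.enorm
        _ = ∑' k, ENNReal.ofReal (∫ t in Ioi (0 : ℝ), ‖F k t‖) := by
            refine tsum_congr fun k => ?_
            rw [ofReal_integral_norm_eq_lintegral_enorm (hFint k)]
        _ < ⊤ := hsummable.tsum_ofReal_lt_top
  · have := hasSum_integral_of_summable_integral_norm hFint hsummable
    rw [htsum]
    simpa only [hF, integral_const_mul] using this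

/-! ### The Laplace transform of J₀ and its moments. -/

lemma integral_pow_mul_exp_neg_mul_Ioi (k : ℕ) {r : ℝ} (hr : 0 < r) :
    ∫ t in Ioi (0 : ℝ), t ^ k * Real.exp (-(r * t)) = (k ! : ℝ) / r ^ (k + 1) := by
  have h := Real.integral_rpow_mul_exp_neg_mul_Ioi (a := (k : ℝ) + 1) (by positivity) hr
  rw [Real.Gamma_nat_eq_factorial] at h
  simp only [add_sub_cancel_right, Real.rpow_natCast] at h
  rw [h]
  have : ((k : ℝ) + 1) = ((k + 1 : ℕ) : ℝ) := by push_cast; ring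
  rw [this, Real.rpow_natCast]
  rw [one_div, inv_pow]
  field_simp

lemma integrableOn_pow_mul_exp_neg_mul_Ioi (k : ℕ) {r : ℝ} (hr : 0 < r) :
    IntegrableOn (fun t : ℝ => t ^ k * Real.exp (-(r * t))) (Ioi 0) := by
  refine Integrable.of_integral_ne_zero ?_
  rw [integral_pow_mul_exp_neg_mul_Ioi k hr]
  positivity

lemma integral_exp_neg_mul_cos_Ioi {l : ℝ} (hl : 0 < l) (ω : ℝ) :
    ∫ t in Ioi (0 : ℝ), Real.exp (-(l * t)) * Real.cos (ω * t) = l / (l ^ 2 + ω ^ 2) := by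
  have hre : (-(l : ℂ) + ω * Complex.I).re < 0 := by simp [hl]
  have h := congrArg Complex.re (integral_exp_mul_complex_Ioi hre 0)
  have h2 := integral_re (𝕜 := ℂ) (integrableOn_exp_mul_complex_Ioi hre 0)
  simp only [RCLike.re_to_complex] at h2
  rw [← h2] at h
  have e : ∀ t : ℝ, (Complex.exp ((-(l : ℂ) + ω * Complex.I) * t)).re =
      Real.exp (-(l * t)) * Real.cos (ω * t) := by
    intro t
    rw [Complex.exp_re]
    simp
  simp only [e] at h
  rw [h]
  simp [Complex.div_re, Complex.normSq_apply]
  ring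

/-- `∫₀^π l / (l² + y² sin² θ) dθ = π / √(l² + y²)`. -/
lemma integral_div_sq_add_sq_mul_sin_sq {l : ℝ} (hl : 0 < l) (y : ℝ) :
    ∫ θ in (0 : ℝ)..π, l / (l ^ 2 + (y * Real.sin θ) ^ 2) = π / √(l ^ 2 + y ^ 2) := by
  set s := √(l ^ 2 + y ^ 2) with hs
  have hP : 0 < l ^ 2 + y ^ 2 := by positivity
  have hspos : 0 < s := Real.sqrt_pos.2 hP
  have hsq : s ^ 2 = l ^ 2 + y ^ 2 := Real.sq_sqrt hP.le
  have hc : 0 < l / s := by positivity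
  -- The antiderivative uses cot rather than tan: it is smooth on all of (0, π), with no jump at
  -- π/2, and only the endpoint limits are needed.
  have hderiv : ∀ θ ∈ Ioo (0 : ℝ) π,
      HasDerivAt (fun θ => -(1 / s * Real.arctan (l / s * (Real.cos θ / Real.sin θ))))
        (l / (l ^ 2 + (y * Real.sin θ) ^ 2)) θ := by
    intro θ hθ
    have hsin : 0 < Real.sin θ := Real.sin_pos_of_pos_of_lt_pi hθ.1 hθ.2
    have h := ((((Real.hasDerivAt_cos θ).div (Real.hasDerivAt_sin θ) hsin.ne').const_mul
      (l / s)).arctan.const_mul (1 / s)).neg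
    refine h.congr_deriv ?_
    simp only [Pi.div_apply]
    have h1 : -Real.sin θ * Real.sin θ - Real.cos θ * Real.cos θ = -1 := by
      nlinarith [Real.sin_sq_add_cos_sq θ]
    have h2 : l ^ 2 + (y * Real.sin θ) ^ 2 = s ^ 2 * Real.sin θ ^ 2 + l ^ 2 * Real.cos θ ^ 2 := by
      rw [hsq, mul_pow]
      linear_combination -l ^ 2 * Real.sin_sq_add_cos_sq θ
    rw [h1, h2]
    have h3 : 0 < s ^ 2 * Real.sin θ ^ 2 + l ^ 2 * Real.cos θ ^ 2 := by positivity
    field_simp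
  have hcont : Continuous fun θ : ℝ => l / (l ^ 2 + (y * Real.sin θ) ^ 2) :=
    continuous_const.div (by fun_prop) fun θ => by positivity
  have hsin0 : Filter.Tendsto Real.sin (nhdsWithin 0 (Ioi 0)) (nhdsWithin 0 (Ioi 0)) := by
    refine tendsto_nhdsWithin_iff.2 ⟨?_, ?_⟩
    · exact (Real.continuous_sin.tendsto' 0 0 Real.sin_zero).mono_left nhdsWithin_le_nhds
    · filter_upwards [Ioo_mem_nhdsGT Real.pi_pos] with θ hθ
      exact Real.sin_pos_of_pos_of_lt_pi hθ.1 hθ.2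
  have hsinpi : Filter.Tendsto Real.sin (nhdsWithin π (Iio π)) (nhdsWithin 0 (Ioi 0)) := by
    refine tendsto_nhdsWithin_iff.2 ⟨?_, ?_⟩
    · exact (Real.continuous_sin.tendsto' π 0 Real.sin_pi).mono_left nhdsWithin_le_nhds
    · filter_upwards [Ioo_mem_nhdsLT Real.pi_pos] with θ hθ
      exact Real.sin_pos_of_pos_of_lt_pi hθ.1 hθ.2
  have hcot0 : Filter.Tendsto (fun θ => l / s * (Real.cos θ / Real.sin θ))
      (nhdsWithin 0 (Ioi 0)) Filter.atTop := by
    refine Filter.Tendsto.const_mul_atTop hc ?_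
    simp only [div_eq_mul_inv]
    exact Filter.Tendsto.pos_mul_atTop one_pos
      ((Real.continuous_cos.tendsto' 0 1 Real.cos_zero).mono_left nhdsWithin_le_nhds)
      (tendsto_inv_nhdsGT_zero.comp hsin0)
  have hcotpi : Filter.Tendsto (fun θ => l / s * (Real.cos θ / Real.sin θ))
      (nhdsWithin π (Iio π)) Filter.atBot := by
    refine Filter.Tendsto.const_mul_atBot hc ?_
    simp only [div_eq_mul_inv]
    exact Filter.Tendsto.neg_mul_atTop (by norm_num : (-1 : ℝ) < 0)
      ((Real.continuous_cos.tendsto' π (-1) Real.cos_pi).mono_left nhdsWithin_le_nhds)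
      (tendsto_inv_nhdsGT_zero.comp hsinpi)
  have h0 := (((Real.tendsto_arctan_atTop.mono_right nhdsWithin_le_nhds).comp hcot0).const_mul
    (1 / s)).neg
  have hpi := (((Real.tendsto_arctan_atBot.mono_right nhdsWithin_le_nhds).comp hcotpi).const_mul
    (1 / s)).neg
  rw [intervalIntegral.integral_eq_sub_of_hasDerivAt_of_tendsto Real.pi_pos hderiv
    (hcont.intervalIntegrable 0 π) h0 hpi]
  field_simp
  ring

/-- The Laplace transform of `J₀`. -/
lemma integral_exp_neg_mul_besselJ0 {l : ℝ} (hl : 0 < l) (y : ℝ) :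
    ∫ t in Ioi (0 : ℝ), Real.exp (-(l * t)) * besselJ0 (y * t) = 1 / √(l ^ 2 + y ^ 2) := by
  have e : ∀ t : ℝ, Real.exp (-(l * t)) * besselJ0 (y * t) =
      1 / π * ∫ θ in Ioc (0 : ℝ) π, Real.exp (-(l * t)) * Real.cos (y * Real.sin θ * t) := by
    intro t
    rw [besselJ0_eq_integral, intervalIntegral.integral_of_le Real.pi_pos.le, integral_const_mul]
    have : ∀ θ, y * t * Real.sin θ = y * Real.sin θ * t := fun θ => by ring
    simp only [this]
    ring
  simp only [e]
  rw [integral_const_mul]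
  have hint : Integrable (Function.uncurry fun t θ : ℝ =>
      Real.exp (-(l * t)) * Real.cos (y * Real.sin θ * t))
      ((volume.restrict (Ioi 0)).prod (volume.restrict (Ioc 0 π))) := by
    have h1 : Integrable (fun t : ℝ => Real.exp (-(l * t))) (volume.restrict (Ioi 0)) := by
      have := integrableOn_pow_mul_exp_neg_mul_Ioi 0 hl
      simp only [pow_zero, one_mul] at this
      exact this
    have h2 : Integrable (fun _ : ℝ => (1 : ℝ)) (volume.restrict (Ioc 0 π)) :=
      integrable_const 1
    refine (h1.mul_prod h2).mono ?_ (Filter.Eventually.of_forall fun p => ?_)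
    · refine Continuous.aestronglyMeasurable ?_
      simp only [Function.uncurry_def]
      fun_prop
    · simp only [Function.uncurry_def, norm_mul, Real.norm_eq_abs, abs_one]
      exact mul_le_mul_of_nonneg_left (Real.abs_cos_le_one _) (abs_nonneg _)
  rw [integral_integral_swap hint]
  simp only [integral_exp_neg_mul_cos_Ioi hl]
  rw [← intervalIntegral.integral_of_le Real.pi_pos.le, integral_div_sq_add_sq_mul_sin_sq hl]
  have := Real.pi_pos
  field_simp

lemma norm_pow_mul_exp_mul_besselJ0_le (k : ℕ) (l y : ℝ) {t : ℝ} (ht : 0 < t) :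
    ‖t ^ k * Real.exp (-(l * t)) * besselJ0 (y * t)‖ ≤ t ^ k * Real.exp (-(l * t)) := by
  rw [norm_mul, Real.norm_of_nonneg (by positivity)]
  exact mul_le_of_le_one_right (by positivity) (abs_besselJ0_le_one _)

lemma integrableOn_pow_mul_exp_mul_besselJ0 (k : ℕ) {l : ℝ} (hl : 0 < l) (y : ℝ) :
    IntegrableOn (fun t : ℝ => t ^ k * Real.exp (-(l * t)) * besselJ0 (y * t)) (Ioi 0) := by
  have := continuous_besselJ0
  refine (integrableOn_pow_mul_exp_neg_mul_Ioi k hl).mono'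
    (Continuous.aestronglyMeasurable (by fun_prop)) ?_
  filter_upwards [ae_restrict_mem measurableSet_Ioi] with t ht
  exact norm_pow_mul_exp_mul_besselJ0_le k l y ht

/-- The moments of `e^{-lt} J₀(yt)`. -/
lemma integral_pow_mul_exp_mul_besselJ0 (k : ℕ) {l : ℝ} (hl : 0 < l) (y : ℝ) :
    ∫ t in Ioi (0 : ℝ), t ^ k * Real.exp (-(l * t)) * besselJ0 (y * t) =
      (-1) ^ k * invSqrtDeriv y k l := by
  have hJ := continuous_besselJ0
  have key := eq_invSqrtDeriv_of_hasDerivAt (U := Ioi 0) isOpen_Ioi (m := y) (C := 1)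
    (fun x hx => by have : 0 < x := hx; positivity)
    (g := fun k l => ∫ t in Ioi (0 : ℝ),
      (-1) ^ k * (t ^ k * Real.exp (-(l * t)) * besselJ0 (y * t)))
    (fun k x hx => ?_) (fun x hx => ?_) k l hl
  · rw [integral_const_mul, one_mul] at key
    rw [← key, ← mul_assoc, ← mul_pow]
    simp
  · have hx : 0 < x := hx
    -- Restricting to l > x/2, together with |J₀| ≤ 1, gives a majorant independent of l.
    refine (hasDerivAt_integral_of_dominated_loc_of_deriv_le
      (μ := volume.restrict (Ioi 0)) (s := Ioi (x / 2)) (x₀ := x)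
      (F := fun l t => (-1) ^ k * (t ^ k * Real.exp (-(l * t)) * besselJ0 (y * t)))
      (F' := fun l t => (-1) ^ (k + 1) * (t ^ (k + 1) * Real.exp (-(l * t)) * besselJ0 (y * t)))
      (bound := fun t => t ^ (k + 1) * Real.exp (-(x / 2 * t)))
      (Ioi_mem_nhds (half_lt_self hx)) ?_ ?_ ?_ ?_ ?_ ?_).2
    · exact Filter.Eventually.of_forall fun l => Continuous.aestronglyMeasurable (by fun_prop)
    · exact (integrableOn_pow_mul_exp_mul_besselJ0 k hx y).const_mul _
    · exact Continuous.aestronglyMeasurable (by fun_prop)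
    · filter_upwards [ae_restrict_mem measurableSet_Ioi] with t ht l hl
      have ht : 0 < t := ht
      have hl : x / 2 < l := hl
      rw [norm_mul, norm_pow, norm_neg, norm_one, one_pow, one_mul]
      refine (norm_pow_mul_exp_mul_besselJ0_le (k + 1) l y ht).trans ?_
      gcongr
    · exact integrableOn_pow_mul_exp_neg_mul_Ioi (k + 1) (by positivity)
    · refine Filter.Eventually.of_forall fun t l _ => ?_
      have h := (((((hasDerivAt_id l).mul_const t).neg.exp).const_mul (t ^ k)).mul_const
        (besselJ0 (y * t))).const_mul ((-1) ^ k)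
      refine h.congr_deriv ?_
      simp only [id, pow_succ, Pi.neg_apply]
      ring
  · simpa using integral_exp_neg_mul_besselJ0 hx y

/-! ### The Fourier cosine transform of K₀ and its moments. -/

/-- Substitute sinh u, using cosh² u + y² = (y²+1) + sinh² u. General y serves the cosine transform,
y = 0 the integrability of 1/cosh. The form `1 ^ 2` matches `invSqrtDeriv 1`. -/
lemma integrableOn_and_integral_cosh_div (y : ℝ) :
    IntegrableOn (fun u : ℝ => Real.cosh u / (Real.cosh u ^ 2 + y ^ 2)) (Ioi 0) ∧
    ∫ u in Ioi (0 : ℝ), Real.cosh u / (Real.cosh u ^ 2 + y ^ 2) = π / 2 / √(y ^ 2 + 1 ^ 2) := by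
  set s := √(y ^ 2 + 1 ^ 2) with hs
  have hP : 0 < y ^ 2 + 1 ^ 2 := by positivity
  have hspos : 0 < s := Real.sqrt_pos.2 hP
  have hsq : s ^ 2 = y ^ 2 + 1 ^ 2 := Real.sq_sqrt hP.le
  have hderiv : ∀ u ∈ Ici (0 : ℝ), HasDerivAt (fun u => 1 / s * Real.arctan (1 / s * Real.sinh u))
      (Real.cosh u / (Real.cosh u ^ 2 + y ^ 2)) u := by
    intro u _
    refine (((Real.hasDerivAt_sinh u).const_mul (1 / s)).arctan.const_mul (1 / s)).congr_deriv ?_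
    have h1 : Real.cosh u ^ 2 + y ^ 2 = s ^ 2 + Real.sinh u ^ 2 := by
      rw [hsq, Real.cosh_sq]; ring
    rw [h1]
    have : 0 < s ^ 2 + Real.sinh u ^ 2 := by positivity
    field_simp
  have hnonneg : ∀ u ∈ Ioi (0 : ℝ), 0 ≤ Real.cosh u / (Real.cosh u ^ 2 + y ^ 2) := by
    intro u _
    have := Real.cosh_pos u
    positivity
  have hsinh : Filter.Tendsto Real.sinh Filter.atTop Filter.atTop := by
    refine Filter.tendsto_atTop_mono' _ ?_ Filter.tendsto_id
    filter_upwards [Filter.eventually_ge_atTop 0] with u hu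
    exact Real.self_le_sinh_iff.2 hu
  have hlim := ((Real.tendsto_arctan_atTop.mono_right nhdsWithin_le_nhds).comp
    (hsinh.const_mul_atTop (by positivity : 0 < 1 / s))).const_mul (1 / s)
  refine ⟨integrableOn_Ioi_deriv_of_nonneg' hderiv hnonneg hlim, ?_⟩
  rw [integral_Ioi_of_hasDerivAt_of_nonneg' hderiv hnonneg hlim]
  simp
  ring

/-- As cosh ≥ 1, every power is dominated by 1/cosh, whose integral is π/2. -/
lemma integrableOn_inv_cosh_pow (k : ℕ) :
    IntegrableOn (fun u : ℝ => 1 / Real.cosh u ^ (k + 1)) (Ioi 0) ∧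
    ∫ u in Ioi (0 : ℝ), 1 / Real.cosh u ^ (k + 1) ≤ π / 2 := by
  obtain ⟨h1, h2⟩ := integrableOn_and_integral_cosh_div 0
  have hle : ∀ u : ℝ, 1 / Real.cosh u ^ (k + 1) ≤ Real.cosh u / (Real.cosh u ^ 2 + 0 ^ 2) := by
    intro u
    have hc := Real.cosh_pos u
    have h := one_le_pow₀ (Real.one_le_cosh u) (n := k)
    have e : Real.cosh u / (Real.cosh u ^ 2 + 0 ^ 2) = 1 / Real.cosh u := by
      field_simp
      ring
    rw [e, pow_succ]
    gcongr
    exact le_mul_of_one_le_left hc.le h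
  have hint : IntegrableOn (fun u : ℝ => 1 / Real.cosh u ^ (k + 1)) (Ioi 0) := by
    refine Integrable.mono' h1 (Continuous.aestronglyMeasurable ?_)
      (Filter.Eventually.of_forall fun u => ?_)
    · exact continuous_const.div (by fun_prop) fun u => (pow_pos (Real.cosh_pos u) _).ne'
    · rw [Real.norm_of_nonneg (by have := Real.cosh_pos u; positivity)]
      exact hle u
  refine ⟨hint, ?_⟩
  calc _ ≤ _ := integral_mono hint h1 hle
    _ = π / 2 := by rw [h2]; simp

lemma integral_pow_mul_exp_neg_mul_cosh (k : ℕ) (u : ℝ) :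
    ∫ t in Ioi (0 : ℝ), t ^ k * Real.exp (-t * Real.cosh u) =
      (k ! : ℝ) * (1 / Real.cosh u ^ (k + 1)) := by
  have := integral_pow_mul_exp_neg_mul_Ioi k (Real.cosh_pos u)
  rw [mul_one_div, ← this]
  refine integral_congr_ae (Filter.Eventually.of_forall fun t => ?_)
  simp only
  congr 2
  ring

/-- Integrating in t first gives k!/cosh^{k+1} u. Through Fubini this supplies measurability,
integrability and moment bounds for K₀ without any estimate near its singularity at 0. -/
lemma integrable_prod_pow_mul_exp_neg_mul_cosh (k : ℕ) :
    Integrable (Function.uncurry fun t u : ℝ => t ^ k * Real.exp (-t * Real.cosh u))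
      ((volume.restrict (Ioi 0)).prod (volume.restrict (Ioi 0))) := by
  rw [integrable_prod_iff']
  · refine ⟨Filter.Eventually.of_forall fun u => ?_, ?_⟩
    · have := integrableOn_pow_mul_exp_neg_mul_Ioi k (Real.cosh_pos u)
      refine this.congr (Filter.Eventually.of_forall fun t => ?_)
      simp only [Function.uncurry_def]
      congr 2
      ring
    · have h := (integrableOn_inv_cosh_pow k).1.const_mul (k ! : ℝ)
      refine Integrable.congr h (Filter.Eventually.of_forall fun u => ?_)
      simp only [Function.uncurry_def]
      rw [← integral_pow_mul_exp_neg_mul_cosh k u]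
      refine setIntegral_congr_fun measurableSet_Ioi fun t ht => ?_
      have ht : 0 < t := ht
      exact (Real.norm_of_nonneg (by positivity)).symm
  · refine Continuous.aestronglyMeasurable ?_
    simp only [Function.uncurry_def]
    fun_prop

lemma besselK0_nonneg (t : ℝ) : 0 ≤ besselK0 t :=
  integral_nonneg fun _ => (Real.exp_pos _).le

lemma integrableOn_pow_mul_besselK0 (k : ℕ) :
    IntegrableOn (fun t : ℝ => t ^ k * besselK0 t) (Ioi 0) := by
  have h := (integrable_prod_pow_mul_exp_neg_mul_cosh k).integral_prod_left
  simp only [Function.uncurry_def, integral_const_mul] at h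
  exact h

lemma aestronglyMeasurable_besselK0 :
    AEStronglyMeasurable besselK0 (volume.restrict (Ioi 0)) := by
  simpa using (integrableOn_pow_mul_besselK0 0).aestronglyMeasurable

lemma integral_pow_mul_besselK0_le (k : ℕ) :
    ∫ t in Ioi (0 : ℝ), t ^ k * besselK0 t ≤ π / 2 * (k ! : ℝ) := by
  have h := integral_integral_swap (integrable_prod_pow_mul_exp_neg_mul_cosh k)
  simp only [integral_pow_mul_exp_neg_mul_cosh, integral_const_mul] at h
  unfold besselK0
  rw [h, mul_comm]
  exact mul_le_mul_of_nonneg_right (integrableOn_inv_cosh_pow k).2 (by positivity)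

/-- The Fourier cosine transform of `K₀`. -/
lemma integral_besselK0_mul_cos (y : ℝ) :
    ∫ t in Ioi (0 : ℝ), besselK0 t * Real.cos (y * t) = π / 2 / √(y ^ 2 + 1 ^ 2) := by
  have hint : Integrable (Function.uncurry fun t u : ℝ =>
      Real.exp (-t * Real.cosh u) * Real.cos (y * t))
      ((volume.restrict (Ioi 0)).prod (volume.restrict (Ioi 0))) := by
    refine (integrable_prod_pow_mul_exp_neg_mul_cosh 0).mono' ?_
      (Filter.Eventually.of_forall fun p => ?_)
    · refine Continuous.aestronglyMeasurable ?_
      simp only [Function.uncurry_def]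
      fun_prop
    · simp only [Function.uncurry_def, norm_mul, Real.norm_eq_abs, Real.abs_exp, pow_zero, one_mul]
      exact mul_le_of_le_one_right (Real.exp_pos _).le (Real.abs_cos_le_one _)
  have h := integral_integral_swap hint
  simp only [integral_mul_const] at h
  unfold besselK0
  rw [h, ← (integrableOn_and_integral_cosh_div y).2]
  refine integral_congr_ae (Filter.Eventually.of_forall fun u => ?_)
  simp only
  rw [← integral_exp_neg_mul_cos_Ioi (Real.cosh_pos u)]
  refine integral_congr_ae (Filter.Eventually.of_forall fun t => ?_)
  simp only
  congr 2
  ring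

lemma norm_pow_mul_besselK0_mul_cos_le (k : ℕ) (x : ℝ) {t : ℝ} (ht : 0 < t) :
    ‖t ^ k * besselK0 t * Real.cos x‖ ≤ t ^ k * besselK0 t := by
  have hK := besselK0_nonneg t
  rw [norm_mul, Real.norm_of_nonneg (by positivity)]
  exact mul_le_of_le_one_right (by positivity) (Real.abs_cos_le_one _)

lemma aestronglyMeasurable_pow_mul_besselK0_mul_cos (k : ℕ) (x b : ℝ) :
    AEStronglyMeasurable (fun t => t ^ k * besselK0 t * Real.cos (x * t + b))
      (volume.restrict (Ioi 0)) :=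
  (integrableOn_pow_mul_besselK0 k).aestronglyMeasurable.mul
    (Continuous.aestronglyMeasurable (by fun_prop))

lemma integrableOn_pow_mul_besselK0_mul_cos (k : ℕ) (x b : ℝ) :
    IntegrableOn (fun t => t ^ k * besselK0 t * Real.cos (x * t + b)) (Ioi 0) := by
  refine (integrableOn_pow_mul_besselK0 k).mono'
    (aestronglyMeasurable_pow_mul_besselK0_mul_cos k x b) ?_
  filter_upwards [ae_restrict_mem measurableSet_Ioi] with t ht
  exact norm_pow_mul_besselK0_mul_cos_le k _ ht

/-- The Fourier moments of `K₀`. -/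
lemma integral_pow_mul_besselK0_mul_cos (k : ℕ) (y : ℝ) :
    ∫ t in Ioi (0 : ℝ), t ^ k * besselK0 t * Real.cos (y * t + k * (π / 2)) =
      π / 2 * invSqrtDeriv 1 k y := by
  refine eq_invSqrtDeriv_of_hasDerivAt (U := univ) isOpen_univ (m := 1) (C := π / 2)
    (fun x _ => by positivity)
    -- The phase kπ/2 encodes the k-th derivative of the cosine without splitting by k mod 4.
    (g := fun k y => ∫ t in Ioi (0 : ℝ), t ^ k * besselK0 t * Real.cos (y * t + k * (π / 2)))
    (fun k x _ => ?_) (fun x _ => ?_) k y (mem_univ y)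
  · refine (hasDerivAt_integral_of_dominated_loc_of_deriv_le
      (μ := volume.restrict (Ioi 0)) (s := univ) (x₀ := x)
      (F := fun y t => t ^ k * besselK0 t * Real.cos (y * t + k * (π / 2)))
      (F' := fun y t => t ^ (k + 1) * besselK0 t * Real.cos (y * t + (k + 1 : ℕ) * (π / 2)))
      (bound := fun t => t ^ (k + 1) * besselK0 t) Filter.univ_mem ?_ ?_ ?_ ?_ ?_ ?_).2
    · exact Filter.Eventually.of_forall fun l =>
        aestronglyMeasurable_pow_mul_besselK0_mul_cos k l _
    · exact integrableOn_pow_mul_besselK0_mul_cos k x _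
    · exact aestronglyMeasurable_pow_mul_besselK0_mul_cos (k + 1) x _
    · filter_upwards [ae_restrict_mem measurableSet_Ioi] with t ht l _
      exact norm_pow_mul_besselK0_mul_cos_le (k + 1) _ ht
    · exact integrableOn_pow_mul_besselK0 (k + 1)
    · refine Filter.Eventually.of_forall fun t l _ => ?_
      have h := ((((hasDerivAt_id l).mul_const t).add_const ((k : ℝ) * (π / 2))).cos).const_mul
        (t ^ k * besselK0 t)
      refine h.congr_deriv ?_
      have : l * t + ((k + 1 : ℕ) : ℝ) * (π / 2) = l * t + k * (π / 2) + π / 2 := by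
        push_cast; ring
      rw [this, Real.cos_add_pi_div_two]
      simp only [id, pow_succ]
      ring
  · simpa using integral_besselK0_mul_cos x

/-! ### Summing the moment series. -/

/-- `r^k / (k!)²` times the `k`-th derivative of `(x² + m²)^{-1/2}`, for `r = c (x² + m²)`. -/
lemma pow_div_mul_invSqrtDeriv (m x c : ℝ) (k : ℕ) (h : 0 < x ^ 2 + m ^ 2) :
    (c * (x ^ 2 + m ^ 2)) ^ k / (k ! : ℝ) ^ 2 * invSqrtDeriv m k x =
      1 / √(x ^ 2 + m ^ 2) * ((-c) ^ k * legendreCoeff (-(m ^ 2 / 4)) k x) := by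
  have h1 : ((k)! : ℝ) ≠ 0 := by positivity
  have h2 : 0 < √(x ^ 2 + m ^ 2) := Real.sqrt_pos.2 h
  have h3 := (pow_pos h k).ne'
  rw [invSqrtDeriv, mul_pow, neg_pow c k]
  field_simp

/-- The complex form of the identities for `e^{-t} J₀(yt)`. -/
lemma integral_besselSeries_mul_exp_mul_besselJ0 (c y : ℝ) :
    IntegrableOn (fun t : ℝ => besselSeries (Complex.I * ((c * (1 + y ^ 2) : ℝ) : ℂ) * t) *
      ((Real.exp (-t) * besselJ0 (y * t) : ℝ) : ℂ)) (Ioi 0) ∧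
    ∫ t in Ioi (0 : ℝ), besselSeries (Complex.I * ((c * (1 + y ^ 2) : ℝ) : ℂ) * t) *
      ((Real.exp (-t) * besselJ0 (y * t) : ℝ) : ℂ) =
      ((1 / √(1 + y ^ 2) * besselI0 (c * y) : ℝ) : ℂ) * Complex.exp (c * Complex.I) := by
  have hcast : ∀ (k : ℕ) (t : ℝ), (t : ℂ) ^ k * ((Real.exp (-t) * besselJ0 (y * t) : ℝ) : ℂ) =
      ((t ^ k * Real.exp (-(1 * t)) * besselJ0 (y * t) : ℝ) : ℂ) := by
    intro k t
    rw [one_mul]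
    push_cast
    ring
  have hreal := fun k => integrableOn_pow_mul_exp_mul_besselJ0 k one_pos y
  obtain ⟨h1, h2⟩ := integrable_and_hasSum_besselSeries_mul (C := 1)
    (h := fun t : ℝ => ((Real.exp (-t) * besselJ0 (y * t) : ℝ) : ℂ))
    (fun k => by simp only [hcast]; exact (hreal k).ofReal)
    (fun k => by
      simp only [hcast, Complex.norm_real, one_mul]
      have e := integral_pow_mul_exp_neg_mul_Ioi k one_pos
      simp only [one_mul, one_pow, div_one] at e
      rw [← e]
      refine setIntegral_mono_on ?_ ?_ measurableSet_Ioi fun t ht => ?_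
      · have := (hreal k).norm
        simp only [one_mul] at this
        exact this
      · simpa only [one_mul] using integrableOn_pow_mul_exp_neg_mul_Ioi k one_pos
      · simpa only [one_mul] using norm_pow_mul_exp_mul_besselJ0_le k 1 y ht)
    (Complex.I * ((c * (1 + y ^ 2) : ℝ) : ℂ))
  refine ⟨h1, ?_⟩
  have hsum := (hasSum_pow_mul_legendreCoeff (-(y ^ 2 / 4)) 1 (c * Complex.I)).mul_left
    ((1 / √(1 + y ^ 2) : ℝ) : ℂ)
  have hterm : ∀ k : ℕ, (Complex.I * ((c * (1 + y ^ 2) : ℝ) : ℂ)) ^ k / (k ! : ℂ) ^ 2 *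
      ∫ t in Ioi (0 : ℝ), (t : ℂ) ^ k * ((Real.exp (-t) * besselJ0 (y * t) : ℝ) : ℂ) =
      ((1 / √(1 + y ^ 2) : ℝ) : ℂ) *
        ((c * Complex.I) ^ k * (legendreCoeff (-(y ^ 2 / 4)) k 1 : ℂ)) := by
    intro k
    simp only [hcast]
    rw [integral_complex_ofReal, integral_pow_mul_exp_mul_besselJ0 k one_pos]
    have h := pow_div_mul_invSqrtDeriv y 1 c k (by positivity)
    rw [one_pow, neg_pow c k] at h
    -- One sign comes from the moment and one from `invSqrtDeriv`; they cancel, so r = ic rather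
    -- than -ic.
    have hk : ((-1 : ℝ) ^ k) * (-1) ^ k = 1 := by rw [← mul_pow]; simp
    have h' : (c * (1 + y ^ 2)) ^ k / (k ! : ℝ) ^ 2 * ((-1) ^ k * invSqrtDeriv y k 1) =
        1 / √(1 + y ^ 2) * (c ^ k * legendreCoeff (-(y ^ 2 / 4)) k 1) := by
      calc _ = (-1) ^ k * ((c * (1 + y ^ 2)) ^ k / (k ! : ℝ) ^ 2 * invSqrtDeriv y k 1) := by ring
        _ = ((-1 : ℝ) ^ k * (-1) ^ k) *
            (1 / √(1 + y ^ 2) * (c ^ k * legendreCoeff (-(y ^ 2 / 4)) k 1)) := by rw [h]; ring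
        _ = _ := by rw [hk, one_mul]
    have h'' := congrArg (fun x : ℝ => Complex.I ^ k * (x : ℂ)) h'
    rw [mul_pow, mul_pow]
    push_cast at h'' ⊢
    linear_combination h''
  simp only [hterm] at h2
  rw [h2.unique hsum, Complex.ofReal_mul, ofReal_besselI0, besselSeries]
  have e : ((c : ℂ) * Complex.I) ^ 2 * ((-(y ^ 2 / 4) : ℝ) : ℂ) = ((c * y : ℝ) : ℂ) ^ 2 / 4 := by
    rw [mul_pow, Complex.I_sq]
    push_cast
    ring
  rw [e]
  push_cast
  rw [mul_one]
  ring

/-- The complex form of the identities for `K₀(t) e^{iyt}`. -/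
lemma integral_besselSeries_mul_besselK0 (c y : ℝ) :
    IntegrableOn (fun t : ℝ => (besselSeries (Complex.I * ((c * (1 + y ^ 2) : ℝ) : ℂ) * t) *
      (besselK0 t * Complex.exp ((y * t : ℝ) * Complex.I))).re) (Ioi 0) ∧
    ∫ t in Ioi (0 : ℝ), (besselSeries (Complex.I * ((c * (1 + y ^ 2) : ℝ) : ℂ) * t) *
      (besselK0 t * Complex.exp ((y * t : ℝ) * Complex.I))).re =
      π / 2 * (1 / √(1 + y ^ 2)) * (besselJ0 c * Real.exp (-(c * y))) := by
  have hnorm : ∀ (k : ℕ), ∀ t ∈ Ioi (0 : ℝ),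
      ‖(t : ℂ) ^ k * (besselK0 t * Complex.exp ((y * t : ℝ) * Complex.I))‖ =
        t ^ k * besselK0 t := by
    intro k t ht
    have ht : 0 < t := ht
    rw [norm_mul, norm_mul, Complex.norm_exp_ofReal_mul_I, norm_pow, Complex.norm_real,
      Complex.norm_real, Real.norm_of_nonneg ht.le, Real.norm_of_nonneg (besselK0_nonneg t),
      mul_one]
  have hint : ∀ k : ℕ, IntegrableOn (fun t : ℝ =>
      (t : ℂ) ^ k * (besselK0 t * Complex.exp ((y * t : ℝ) * Complex.I))) (Ioi 0) := by
    intro k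
    refine (integrableOn_pow_mul_besselK0 k).mono' ?_ ?_
    · exact (Continuous.aestronglyMeasurable (by fun_prop)).mul
        ((Complex.continuous_ofReal.comp_aestronglyMeasurable aestronglyMeasurable_besselK0).mul
          (Continuous.aestronglyMeasurable (by fun_prop)))
    · filter_upwards [ae_restrict_mem measurableSet_Ioi] with t ht
      exact (hnorm k t ht).le
  obtain ⟨h1, h2⟩ := integrable_and_hasSum_besselSeries_mul (C := π / 2)
    (h := fun t : ℝ => (besselK0 t * Complex.exp ((y * t : ℝ) * Complex.I))) hint
    (fun k => by
      rw [setIntegral_congr_fun measurableSet_Ioi (hnorm k)]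
      exact integral_pow_mul_besselK0_le k)
    (Complex.I * ((c * (1 + y ^ 2) : ℝ) : ℂ))
  refine ⟨h1.re, ?_⟩
  have hre := integral_re (𝕜 := ℂ) h1
  simp only [RCLike.re_to_complex] at hre
  rw [hre]
  have h3 := Complex.hasSum_re h2
  -- No second sign arises here, hence r = -c. Only real parts are compared: the imaginary ones
  -- would involve the sine transform of K₀.
  have hsum := (Complex.hasSum_re (hasSum_pow_mul_legendreCoeff (-(1 ^ 2 / 4)) y
    ((-c : ℝ) : ℂ))).mul_left (π / 2 * (1 / √(1 + y ^ 2)))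
  have hterm : ∀ k : ℕ, ((Complex.I * ((c * (1 + y ^ 2) : ℝ) : ℂ)) ^ k / (k ! : ℂ) ^ 2 *
      ∫ t in Ioi (0 : ℝ),
        (t : ℂ) ^ k * (besselK0 t * Complex.exp ((y * t : ℝ) * Complex.I))).re =
      π / 2 * (1 / √(1 + y ^ 2)) *
        (((-c : ℝ) : ℂ) ^ k * (legendreCoeff (-(1 ^ 2 / 4)) k y : ℂ)).re := by
    intro k
    -- The factor iᵏ from the series argument is precisely the phase kπ/2 of the Fourier moments.
    have hrot : ∀ t : ℝ, (Complex.I ^ k *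
        ((t : ℂ) ^ k * (besselK0 t * Complex.exp ((y * t : ℝ) * Complex.I)))).re =
        t ^ k * besselK0 t * Real.cos (y * t + k * (π / 2)) := by
      intro t
      have e : Complex.I ^ k * Complex.exp ((y * t : ℝ) * Complex.I) =
          Complex.exp ((y * t + k * (π / 2) : ℝ) * Complex.I) := by
        have hI : Complex.I ^ k = Complex.exp (k * (π / 2 * Complex.I)) := by
          rw [Complex.exp_nat_mul, Complex.exp_pi_div_two_mul_I]
        rw [hI, ← Complex.exp_add]
        congr 1
        push_cast
        ring
      have e2 : Complex.I ^ k *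
          ((t : ℂ) ^ k * (besselK0 t * Complex.exp ((y * t : ℝ) * Complex.I))) =
          ((t ^ k * besselK0 t : ℝ) : ℂ) *
            Complex.exp ((y * t + k * (π / 2) : ℝ) * Complex.I) := by
        rw [← e]
        push_cast
        ring
      rw [e2, Complex.re_ofReal_mul, Complex.exp_ofReal_mul_I_re]
    have hmom : (Complex.I ^ k * ∫ t in Ioi (0 : ℝ),
        (t : ℂ) ^ k * (besselK0 t * Complex.exp ((y * t : ℝ) * Complex.I))).re =
        π / 2 * invSqrtDeriv 1 k y := by
      rw [← integral_const_mul, ← integral_pow_mul_besselK0_mul_cos]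
      have := integral_re (𝕜 := ℂ) ((hint k).const_mul (Complex.I ^ k))
      simp only [RCLike.re_to_complex, hrot] at this
      exact this.symm
    have hsplit : (Complex.I * ((c * (1 + y ^ 2) : ℝ) : ℂ)) ^ k / (k ! : ℂ) ^ 2 *
        ∫ t in Ioi (0 : ℝ),
          (t : ℂ) ^ k * (besselK0 t * Complex.exp ((y * t : ℝ) * Complex.I)) =
        (((c * (1 + y ^ 2)) ^ k / (k ! : ℝ) ^ 2 : ℝ) : ℂ) * (Complex.I ^ k *
          ∫ t in Ioi (0 : ℝ),
            (t : ℂ) ^ k * (besselK0 t * Complex.exp ((y * t : ℝ) * Complex.I))) := by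
      rw [mul_pow]
      push_cast
      ring
    rw [hsplit, Complex.re_ofReal_mul, hmom, ← Complex.ofReal_pow, ← Complex.ofReal_mul,
      Complex.ofReal_re]
    have h := pow_div_mul_invSqrtDeriv 1 y c k (by positivity)
    rw [one_pow, add_comm (y ^ 2) 1] at h
    rw [one_pow]
    linear_combination π / 2 * h
  simp only [hterm] at h3
  rw [h3.unique hsum]
  have e : (((-c : ℝ) : ℂ)) ^ 2 * ((-(1 ^ 2 / 4) : ℝ) : ℂ) = -((c : ℂ) ^ 2 / 4) := by
    push_cast
    ring
  rw [e, ← besselSeries, ← ofReal_besselJ0, ← Complex.ofReal_mul, ← Complex.ofReal_exp,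
    ← Complex.ofReal_mul, Complex.ofReal_re, neg_mul]
  ring

/-! ### Separating the four real identities. -/

theorem mainTheorem9 (a y : ℝ) :
    (IntegrableOn
        (fun t : ℝ => besselK0 t * kelvinBer (a * √((1 + y ^ 2) * t)) * Real.cos (y * t))
        (Ioi 0) ∧
      π / 2 * (1 + y ^ 2) ^ (-(1 / 2) : ℝ) * besselJ0 (a ^ 2 / 4) * Real.cosh (a ^ 2 * y / 4) =
        ∫ t in Ioi (0 : ℝ),
          besselK0 t * kelvinBer (a * √((1 + y ^ 2) * t)) * Real.cos (y * t)) ∧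
    (IntegrableOn
        (fun t : ℝ => besselK0 t * kelvinBei (a * √((1 + y ^ 2) * t)) * Real.sin (y * t))
        (Ioi 0) ∧
      π / 2 * (1 + y ^ 2) ^ (-(1 / 2) : ℝ) * besselJ0 (a ^ 2 / 4) * Real.sinh (a ^ 2 * y / 4) =
        ∫ t in Ioi (0 : ℝ),
          besselK0 t * kelvinBei (a * √((1 + y ^ 2) * t)) * Real.sin (y * t)) ∧
    (IntegrableOn
        (fun t : ℝ => Real.exp (-t) * kelvinBer (a * √((1 + y ^ 2) * t)) * besselJ0 (y * t))
        (Ioi 0) ∧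
      (1 + y ^ 2) ^ (-(1 / 2) : ℝ) * besselI0 (a ^ 2 * y / 4) * Real.cos (a ^ 2 / 4) =
        ∫ t in Ioi (0 : ℝ),
          Real.exp (-t) * kelvinBer (a * √((1 + y ^ 2) * t)) * besselJ0 (y * t)) ∧
    (IntegrableOn
        (fun t : ℝ => Real.exp (-t) * kelvinBei (a * √((1 + y ^ 2) * t)) * besselJ0 (y * t))
        (Ioi 0) ∧
      (1 + y ^ 2) ^ (-(1 / 2) : ℝ) * besselI0 (a ^ 2 * y / 4) * Real.sin (a ^ 2 / 4) =
        ∫ t in Ioi (0 : ℝ),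
          Real.exp (-t) * kelvinBei (a * √((1 + y ^ 2) * t)) * besselJ0 (y * t)) := by
  have hs : (1 + y ^ 2) ^ (-(1 / 2) : ℝ) = 1 / √(1 + y ^ 2) := by
    rw [Real.rpow_neg (by positivity), ← Real.sqrt_eq_rpow, one_div]
  obtain ⟨hp1, hp2⟩ := integral_besselSeries_mul_besselK0 (a ^ 2 / 4) y
  -- At y and -y the real integrands are K₀(ber cos(yt) ∓ bei sin(yt)), with values proportional to
  -- e^{∓cy}; half the sum and half the difference yield cosh and sinh.
  obtain ⟨hm1, hm2⟩ := integral_besselSeries_mul_besselK0 (a ^ 2 / 4) (-y)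
  obtain ⟨hj1, hj2⟩ := integral_besselSeries_mul_exp_mul_besselJ0 (a ^ 2 / 4) y
  rw [neg_sq] at hm1 hm2
  have hre := hj1.re
  have him := hj1.im
  have hre2 := integral_re (𝕜 := ℂ) hj1
  have him2 := integral_im (𝕜 := ℂ) hj1
  simp only [RCLike.re_to_complex, RCLike.im_to_complex] at hre him hre2 him2
  rw [hj2, Complex.re_ofReal_mul] at hre2
  rw [hj2, Complex.im_ofReal_mul] at him2
  rw [Complex.exp_ofReal_mul_I_re] at hre2
  rw [Complex.exp_ofReal_mul_I_im] at him2
  have hy : a ^ 2 / 4 * y = a ^ 2 * y / 4 := by ring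
  have hny : -(a ^ 2 / 4 * -y) = a ^ 2 * y / 4 := by ring
  have hterm : ∀ (z : ℝ) (t : ℝ), (besselSeries
      (Complex.I * ((a ^ 2 / 4 * (1 + y ^ 2) : ℝ) : ℂ) * t) *
      (besselK0 t * Complex.exp ((z * t : ℝ) * Complex.I))).re =
      besselK0 t * ((besselSeries (Complex.I * ((a ^ 2 / 4 * (1 + y ^ 2) : ℝ) : ℂ) * t)).re *
        Real.cos (z * t) -
        (besselSeries (Complex.I * ((a ^ 2 / 4 * (1 + y ^ 2) : ℝ) : ℂ) * t)).im *
        Real.sin (z * t)) := by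
    intro z t
    rw [Complex.mul_re, Complex.re_ofReal_mul, Complex.im_ofReal_mul,
      Complex.exp_ofReal_mul_I_re, Complex.exp_ofReal_mul_I_im]
    ring
  have hcos : ∀ t ∈ Ioi (0 : ℝ), (1 / 2 : ℝ) * ((besselSeries
      (Complex.I * ((a ^ 2 / 4 * (1 + y ^ 2) : ℝ) : ℂ) * t) *
      (besselK0 t * Complex.exp ((-y * t : ℝ) * Complex.I))).re + (besselSeries
      (Complex.I * ((a ^ 2 / 4 * (1 + y ^ 2) : ℝ) : ℂ) * t) *
      (besselK0 t * Complex.exp ((y * t : ℝ) * Complex.I))).re) =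
      besselK0 t * kelvinBer (a * √((1 + y ^ 2) * t)) * Real.cos (y * t) := by
    intro t ht
    rw [hterm, hterm, kelvinBer_eq a y (le_of_lt ht), neg_mul y t, Real.cos_neg, Real.sin_neg]
    ring
  have hsin : ∀ t ∈ Ioi (0 : ℝ), (1 / 2 : ℝ) * ((besselSeries
      (Complex.I * ((a ^ 2 / 4 * (1 + y ^ 2) : ℝ) : ℂ) * t) *
      (besselK0 t * Complex.exp ((-y * t : ℝ) * Complex.I))).re - (besselSeries
      (Complex.I * ((a ^ 2 / 4 * (1 + y ^ 2) : ℝ) : ℂ) * t) *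
      (besselK0 t * Complex.exp ((y * t : ℝ) * Complex.I))).re) =
      besselK0 t * kelvinBei (a * √((1 + y ^ 2) * t)) * Real.sin (y * t) := by
    intro t ht
    rw [hterm, hterm, kelvinBei_eq a y (le_of_lt ht), neg_mul y t, Real.cos_neg, Real.sin_neg]
    ring
  have hber : ∀ t ∈ Ioi (0 : ℝ),
      (besselSeries (Complex.I * ((a ^ 2 / 4 * (1 + y ^ 2) : ℝ) : ℂ) * t) *
        ((Real.exp (-t) * besselJ0 (y * t) : ℝ) : ℂ)).re =
      Real.exp (-t) * kelvinBer (a * √((1 + y ^ 2) * t)) * besselJ0 (y * t) := by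
    intro t ht
    rw [kelvinBer_eq a y (le_of_lt ht), Complex.re_mul_ofReal]
    ring
  have hbei : ∀ t ∈ Ioi (0 : ℝ),
      (besselSeries (Complex.I * ((a ^ 2 / 4 * (1 + y ^ 2) : ℝ) : ℂ) * t) *
        ((Real.exp (-t) * besselJ0 (y * t) : ℝ) : ℂ)).im =
      Real.exp (-t) * kelvinBei (a * √((1 + y ^ 2) * t)) * besselJ0 (y * t) := by
    intro t ht
    rw [kelvinBei_eq a y (le_of_lt ht), Complex.im_mul_ofReal]
    ring
  rw [hs]
  refine ⟨⟨?_, ?_⟩, ⟨?_, ?_⟩, ⟨?_, ?_⟩, ⟨?_, ?_⟩⟩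
  · exact IntegrableOn.congr_fun ((hm1.add hp1).const_mul (1 / 2)) hcos measurableSet_Ioi
  · rw [← setIntegral_congr_fun measurableSet_Ioi hcos, integral_const_mul, integral_add hm1 hp1,
      hm2, hp2, hny, hy, Real.cosh_eq]
    ring
  · exact IntegrableOn.congr_fun ((hm1.sub hp1).const_mul (1 / 2)) hsin measurableSet_Ioi
  · rw [← setIntegral_congr_fun measurableSet_Ioi hsin, integral_const_mul, integral_sub hm1 hp1,
      hm2, hp2, hny, hy, Real.sinh_eq]
    ring
  · exact IntegrableOn.congr_fun hre hber measurableSet_Ioi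
  · rw [← setIntegral_congr_fun measurableSet_Ioi hber, hre2, hy]
  · exact IntegrableOn.congr_fun him hbei measurableSet_Ioi
  · rw [← setIntegral_congr_fun measurableSet_Ioi hbei, him2, hy]
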